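/- Let $G=\langle x,y \mid x^2=y^4=(xy)^8=1\rangle$. Then $G$ has uncountably many quotients each of which is a $2$-group (this answers Wiegold's question 16.101 in the Kourovka Notebook affirmatively), and some of these can be taken residually finite. Precisely: (1) The set of normal subgroups $K\lhd G$ such that $G/K$ is a $2$-group (every element has order a power of $2$) is uncountable. (2) Let $E\lhd G$ be the normal subgroup generated by all squares $b^2$ of elements $b$ of the kernel of the natural homomorphism $G\to \langle x\rangle_2\times\langle y\rangle_4$ onto the direct product of cyclic groups of orders $2$ and $4$ (sending $x$ and $y$ to generators of the first and the second factor). Then $|G:E|=2^6$, and there is a normal subgroup $N\lhd G$ with $N\le E$ and $|G:N|=2^l$ for some $l\in\mathbb N$ that maps homomorphically onto a non-abelian free group. (3) With $N$ as in (2), there is a family $(K_\omega)_{\omega\in\{0,1\}^{\mathbb N}}$ of normal subgroups of $G$ contained in $N$ such that each quotient $G/K_\omega$ is a residually finite $2$-group, and $G/K_\omega\not\cong G/K_{\omega'}$ whenever $\omega\ne\omega'$. In particular $G$ has $2^{\aleph_0}$ pairwise non-isomorphic residually finite quotients that are $2$-groups. -/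

import Mathlib

namespace Wiegold

/-- The relators `x ^ 2`, `y ^ 4`, `(x * y) ^ 8`, where `x` and `y` are the two free generators. -/
def relators : Set (FreeGroup (Fin 2)) :=
  {FreeGroup.of 0 ^ 2, FreeGroup.of 1 ^ 4, (FreeGroup.of 0 * FreeGroup.of 1) ^ 8}

/-- The group `⟨x, y | x ^ 2 = y ^ 4 = (x * y) ^ 8 = 1⟩`. -/
abbrev G : Type := PresentedGroup relators

/-- The images of the generators `x`, `y` in the direct product of cyclic groups of order 2 and 4:
`x` goes to a generator of the first factor and `y` to a generator of the second. -/
def genImage : Fin 2 → Multiplicative (ZMod 2) × Multiplicative (ZMod 4) :=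
  ![(Multiplicative.ofAdd 1, 1), (1, Multiplicative.ofAdd 1)]

theorem genImage_relators : ∀ r ∈ relators, FreeGroup.lift genImage r = 1 := by
  intro r hr
  rcases hr with rfl | rfl | rfl
  · simp only [map_pow, FreeGroup.lift_apply_of]; decide
  · simp only [map_pow, FreeGroup.lift_apply_of]; decide
  · simp only [map_pow, map_mul, FreeGroup.lift_apply_of]; decide

/-- The natural homomorphism from `G` onto `⟨x⟩₂ × ⟨y⟩₄`. -/
def toProd : G →* Multiplicative (ZMod 2) × Multiplicative (ZMod 4) :=
  PresentedGroup.toGroup genImage_relators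

/-- The normal subgroup of `G` generated by the squares of the elements of the kernel of the natural
homomorphism `G → ⟨x⟩₂ × ⟨y⟩₄`. -/
def E : Subgroup G :=
  Subgroup.normalClosure {g : G | ∃ b ∈ toProd.ker, g = b ^ 2}

end Wiegold

namespace Wiegold

open Equiv (Perm)

/-! ### Automorphisms of the binary tree -/

/-! The quotients come from groups of Grigorchuk type acting on the binary tree. A sequence `w` of
characters of the four-group defines directed automorphisms, which together with `swap` generate a
group. If every element of the four-group is killed by infinitely many `w n`, this is a 2-group
(`HasLength.isTwoElement`): passing to sections, after squaring if necessary, eventually shortens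
words. For the sequences `blocks s` with first block `chi₀, chi₁, chi₂`, the elements `x = (-1, -1)`
and `y = swap * (-1, 1)` satisfy the relations of `G`, which gives `treeHom s`.

Different `s` give different kernels (`ker_treeHom_injective`). A fourth power separates two
sequences where they first differ (`Separated.of_ne`), and commutators transport the separating word
up the tree (`Separated.of_shift`). Such a word need not lie in the image of `G`, but it normalizes
the image, so a commutator with an element of `G` separates the kernels.

One can take `N = E`. Modulo `E` the conjugates of `x` by powers of `y` are commuting involutions,
so the index is at most `2 ^ 4 * 4`; the wreath product of cyclic groups of orders 2 and 4 shows
equality (`index_E`). A wreath product over a free group extended by the four-group sends `E` to a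
nonabelian subgroup of a free group, which is free by Nielsen–Schreier.

The subgroups `treeKer s`, the intersections of the kernels with `E`, give residually finite
2-groups. Each isomorphism class contains only countably many parameters
(`countable_setOf_mulEquiv`), so a continuum of classes remains. -/

/-- The permutation of the vertices of the binary tree that acts as `g.1` on the subtree below
`false` and as `g.2` on the subtree below `true`. -/
def node : Perm (List Bool) × Perm (List Bool) →* Perm (List Bool) :=
  MonoidHom.toHomPerm
    { toFun := fun g l => match l with
        | [] => []
        | false :: l => false :: g.1 l
        | true :: l => true :: g.2 l
      map_one' := by
        funext l
        rcases l with _ | ⟨_ | _, l⟩ <;> rfl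
      map_mul' := fun g h => by
        funext l
        rcases l with _ | ⟨_ | _, l⟩ <;> rfl }

@[simp] theorem node_nil (g : Perm (List Bool) × Perm (List Bool)) : node g [] = [] := rfl

@[simp] theorem node_false (g : Perm (List Bool) × Perm (List Bool)) (l : List Bool) :
    node g (false :: l) = false :: g.1 l := rfl

@[simp] theorem node_true (g : Perm (List Bool) × Perm (List Bool)) (l : List Bool) :
    node g (true :: l) = true :: g.2 l := rfl

theorem node_injective : Function.Injective node := by
  intro g h e
  refine Prod.ext (Equiv.ext fun l => ?_) (Equiv.ext fun l => ?_)
  · simpa using DFunLike.congr_fun e (false :: l)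
  · simpa using DFunLike.congr_fun e (true :: l)

/-- The permutation that exchanges the two subtrees below the root. -/
def swap : Perm (List Bool) :=
  Function.Involutive.toPerm
    (fun l => match l with
      | [] => []
      | b :: l => (!b) :: l)
    (fun l => by rcases l with _ | ⟨_ | _, l⟩ <;> rfl)

@[simp] theorem swap_nil : swap [] = [] := rfl

@[simp] theorem swap_cons (b : Bool) (l : List Bool) : swap (b :: l) = (!b) :: l := rfl

@[simp] theorem swap_mul_swap : swap * swap = 1 := by
  ext1 l
  rcases l with _ | ⟨b, l⟩ <;> simp

@[simp] theorem swap_mul_swap_mul (g : Perm (List Bool)) : swap * (swap * g) = g := by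
  rw [← mul_assoc, swap_mul_swap, one_mul]

@[simp] theorem swap_inv : swap⁻¹ = swap := inv_eq_of_mul_eq_one_left swap_mul_swap

theorem swap_mul_node (g h : Perm (List Bool)) : swap * node (g, h) = node (h, g) * swap := by
  ext1 l
  rcases l with _ | ⟨_ | _, l⟩ <;> simp

theorem swap_mul_node_mul (g h k : Perm (List Bool)) :
    swap * (node (g, h) * k) = node (h, g) * (swap * k) := by
  rw [← mul_assoc, swap_mul_node, mul_assoc]

theorem node_mul_node (g h g' h' : Perm (List Bool)) :
    node (g, h) * node (g', h') = node (g * g', h * h') := by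
  rw [← map_mul, Prod.mk_mul_mk]

theorem node_mul_node_mul (g h g' h' k : Perm (List Bool)) :
    node (g, h) * (node (g', h') * k) = node (g * g', h * h') * k := by
  rw [← mul_assoc, node_mul_node]

theorem node_inv (g h : Perm (List Bool)) : (node (g, h))⁻¹ = node (g⁻¹, h⁻¹) := by
  rw [← map_inv, Prod.inv_mk]

theorem node_one : node (1, 1) = 1 := map_one node

/-- A sign acts on the tree by exchanging or fixing the two subtrees below the root. -/
def rooted : ℤˣ →* Perm (List Bool) where
  toFun u := if u = 1 then 1 else swap
  map_one' := rfl
  map_mul' u v := by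
    rcases Int.units_eq_one_or u with rfl | rfl <;> rcases Int.units_eq_one_or v with rfl | rfl <;>
      simp

theorem rooted_neg_one : rooted (-1) = swap := rfl

/-! ### Directed automorphisms -/

variable {V : Type*} [CommGroup V]

/-- The action on the tree of the directed automorphism with parameters `w`. -/
def directedFun : List Bool → (ℕ → V →* ℤˣ) → V → List Bool
  | [], _, _ => []
  | false :: l, w, v => false :: rooted (w 0 v) l
  | true :: l, w, v => true :: directedFun l (fun n => w (n + 1)) v

/-- The directed automorphisms of the binary tree with parameters `w`: `v` acts on the subtree below
the vertex `true ^ n false` through the sign `w n v`. -/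
def directed (w : ℕ → V →* ℤˣ) : V →* Perm (List Bool) :=
  MonoidHom.toHomPerm
    { toFun := fun v l => directedFun l w v
      map_one' := by
        funext l
        change directedFun l w 1 = l
        induction l generalizing w with
        | nil => rfl
        | cons b l ih => cases b <;> simp_all [directedFun]
      map_mul' := fun v v' => by
        funext l
        change _ = directedFun (directedFun l w v') w v
        induction l generalizing w with
        | nil => rfl
        | cons b l ih => cases b <;> simp_all [directedFun] }

theorem directed_eq_node (w : ℕ → V →* ℤˣ) (v : V) :
    directed w v = node (rooted (w 0 v), directed (fun n => w (n + 1)) v) := by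
  ext1 l
  rcases l with _ | ⟨_ | _, l⟩ <;> rfl

theorem directed_of_eq_one {w : ℕ → V →* ℤˣ} {v : V} (h : w 0 v = 1) :
    directed w v = node (1, directed (fun n => w (n + 1)) v) := by
  rw [directed_eq_node, h, map_one]

theorem directed_of_eq_neg_one {w : ℕ → V →* ℤˣ} {v : V} (h : w 0 v = -1) :
    directed w v = node (swap, directed (fun n => w (n + 1)) v) := by
  rw [directed_eq_node, h, rooted_neg_one]

/-! ### Torsion -/

/-- `g` has order a power of two. -/
def IsTwoElement {H : Type*} [Monoid H] (g : H) : Prop := ∃ k : ℕ, g ^ 2 ^ k = 1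

section

variable {H : Type*} [Group H]

theorem IsTwoElement.of_sq {g : H} (h : IsTwoElement (g ^ 2)) : IsTwoElement g := by
  obtain ⟨k, hk⟩ := h
  exact ⟨k + 1, by rw [pow_succ', pow_mul, hk]⟩

theorem IsTwoElement.pow_of_le {g : H} {k m : ℕ} (hg : g ^ 2 ^ k = 1) (h : k ≤ m) :
    g ^ 2 ^ m = 1 := by
  obtain ⟨j, rfl⟩ := Nat.exists_eq_add_of_le h
  rw [pow_add, pow_mul, hg, one_pow]

theorem IsTwoElement.conj {g : H} (h : IsTwoElement g) (c : H) : IsTwoElement (c * g * c⁻¹) := by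
  obtain ⟨k, hk⟩ := h
  exact ⟨k, by rw [conj_pow, hk, mul_one, mul_inv_cancel]⟩

theorem IsTwoElement.mul_comm {g h : H} (e : IsTwoElement (g * h)) : IsTwoElement (h * g) := by
  simpa [mul_assoc] using e.conj h

end

theorem IsTwoElement.node {g h : Perm (List Bool)} (hg : IsTwoElement g) (hh : IsTwoElement h) :
    IsTwoElement (node (g, h)) := by
  obtain ⟨k, hk⟩ := hg
  obtain ⟨m, hm⟩ := hh
  refine ⟨max k m, ?_⟩
  rw [← map_pow, Prod.pow_mk, pow_of_le hk (le_max_left _ _), pow_of_le hm (le_max_right _ _)]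
  exact map_one _

/-- The product of the elements `swap * v`, for `v` in the list `l` of directed automorphisms. -/
def word (w : ℕ → V →* ℤˣ) (l : List V) : Perm (List Bool) :=
  (l.map fun v => swap * directed w v).prod

@[simp] theorem word_nil (w : ℕ → V →* ℤˣ) : word w [] = 1 := rfl

@[simp] theorem word_cons (w : ℕ → V →* ℤˣ) (v : V) (l : List V) :
    word w (v :: l) = swap * directed w v * word w l := by simp [word]

@[simp] theorem word_append (w : ℕ → V →* ℤˣ) (l l' : List V) :
    word w (l ++ l') = word w l * word w l' := by simp [word]

/-- The trailing directed factor merges with the last letter, since directed automorphisms form a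
group. -/
theorem exists_word_mul_directed (w : ℕ → V →* ℤˣ) (l : List V) (hl : l ≠ []) (u : V) :
    ∃ l', l'.length = l.length ∧ word w l * directed w u = word w l' := by
  induction l with
  | nil => exact absurd rfl hl
  | cons v l ih =>
    rcases eq_or_ne l [] with rfl | h
    · exact ⟨[v * u], rfl, by simp [mul_assoc]⟩
    · obtain ⟨l', e, h'⟩ := ih h
      exact ⟨v :: l', by simp [e], by simp [mul_assoc, ← h']⟩

/-- `g` is a product of directed automorphisms and of at most `k` copies of `swap`. -/
def HasLength (w : ℕ → V →* ℤˣ) (k : ℕ) (g : Perm (List Bool)) : Prop :=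
  ∃ (v : V) (l : List V), l.length ≤ k ∧ g = directed w v * word w l

section

variable {w : ℕ → V →* ℤˣ} {g h : Perm (List Bool)} {j k : ℕ}

theorem HasLength.directed (w : ℕ → V →* ℤˣ) (v : V) : HasLength w 0 (directed w v) :=
  ⟨v, [], le_rfl, by simp⟩

theorem HasLength.one (w : ℕ → V →* ℤˣ) : HasLength w 0 1 := by
  simpa using HasLength.directed w 1

theorem HasLength.directed_mul (hg : HasLength w k g) (v : V) :
    HasLength w k (Wiegold.directed w v * g) := by
  obtain ⟨u, l, hl, rfl⟩ := hg
  exact ⟨v * u, l, hl, by simp [mul_assoc]⟩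

theorem HasLength.swap_mul (hg : HasLength w k g) : HasLength w (k + 1) (swap * g) := by
  obtain ⟨u, l, hl, rfl⟩ := hg
  exact ⟨1, u :: l, by simpa using hl, by simp [mul_assoc]⟩

theorem HasLength.mono (hg : HasLength w k g) (h : k ≤ j) : HasLength w j g := by
  obtain ⟨u, l, hl, rfl⟩ := hg
  exact ⟨u, l, hl.trans h, rfl⟩

theorem HasLength.swap (w : ℕ → V →* ℤˣ) : HasLength w 1 swap := by
  simpa using (HasLength.one w).swap_mul

theorem HasLength.mul (hg : HasLength w j g) (hh : HasLength w k h) :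
    HasLength w (j + k) (g * h) := by
  obtain ⟨u, l, hl, rfl⟩ := hg
  rw [mul_assoc]
  refine HasLength.directed_mul ?_ u
  refine HasLength.mono (k := l.length + k) ?_ (by omega)
  clear hl
  induction l with
  | nil => simpa using hh
  | cons v l ih =>
    simp only [word_cons, mul_assoc, List.length_cons]
    exact ((ih.directed_mul v).swap_mul).mono (by omega)

theorem HasLength.inv (hg : HasLength w k g) : ∃ m, HasLength w m g⁻¹ := by
  obtain ⟨u, l, -, rfl⟩ := hg
  rw [mul_inv_rev, ← map_inv]
  suffices h : ∃ m, HasLength w m (word w l)⁻¹ by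
    obtain ⟨m, hm⟩ := h
    exact ⟨m + 0, hm.mul (HasLength.directed w u⁻¹)⟩
  induction l with
  | nil => exact ⟨0, by simpa using HasLength.one w⟩
  | cons v l ih =>
    obtain ⟨m, hm⟩ := ih
    refine ⟨m + (0 + 1), ?_⟩
    rw [word_cons, mul_inv_rev, mul_inv_rev, swap_inv, ← map_inv]
    exact hm.mul ((HasLength.directed w v⁻¹).mul (.swap w))

end

/-- The two sections below the root of `word w l`. -/
def sections (w : ℕ → V →* ℤˣ) : List V → Perm (List Bool) × Perm (List Bool)
  | [] => 1
  | v :: l => (directed (fun n => w (n + 1)) v * (sections w l).2,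
      rooted (w 0 v) * (sections w l).1)

theorem word_eq_node (w : ℕ → V →* ℤˣ) (l : List V) :
    word w l = node (sections w l) * swap ^ l.length := by
  induction l with
  | nil => simp [sections]
  | cons v l ih =>
    have e : sections w l = ((sections w l).1, (sections w l).2) := rfl
    rw [word_cons, ih, directed_eq_node, e, mul_assoc, node_mul_node_mul, swap_mul_node_mul,
      List.length_cons, pow_succ', sections]

/-- Upper bounds for the number of copies of `swap` in the two sections of a word. -/
def swapCounts (w : ℕ → V →* ℤˣ) : List V → ℕ × ℕ
  | [] => (0, 0)
  | v :: l => ((swapCounts w l).2, (if w 0 v = 1 then 0 else 1) + (swapCounts w l).1)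

theorem sections_hasLength (w : ℕ → V →* ℤˣ) (l : List V) :
    HasLength (fun n => w (n + 1)) (swapCounts w l).1 (sections w l).1 ∧
      HasLength (fun n => w (n + 1)) (swapCounts w l).2 (sections w l).2 := by
  induction l with
  | nil => exact ⟨.one _, .one _⟩
  | cons v l ih =>
    refine ⟨ih.2.directed_mul v, ?_⟩
    by_cases h : w 0 v = 1
    · simpa [swapCounts, sections, h] using ih.1
    · rw [← ne_eq, Int.units_ne_iff_eq_neg] at h
      simpa [swapCounts, sections, h, rooted_neg_one, add_comm] using ih.1.swap_mul

theorem swapCounts_le (w : ℕ → V →* ℤˣ) (l : List V) :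
    (swapCounts w l).1 ≤ l.length / 2 ∧ (swapCounts w l).2 ≤ (l.length + 1) / 2 := by
  induction l with
  | nil => exact ⟨Nat.zero_le _, Nat.zero_le _⟩
  | cons v l ih =>
    simp only [swapCounts, List.length_cons]
    split_ifs <;> omega

/-- A letter contributes at most one `swap` to the two sections together, and none when `w 0` kills
it. -/
theorem swapCounts_add_lt (w : ℕ → V →* ℤˣ) (l : List V) (h : ∃ v ∈ l, w 0 v = 1) :
    (swapCounts w l).1 + (swapCounts w l).2 < l.length := by
  have key : ∀ l, (swapCounts w l).1 + (swapCounts w l).2 ≤ l.length := by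
    intro l
    induction l with
    | nil => exact le_rfl
    | cons v l ih =>
      simp only [swapCounts, List.length_cons]
      split_ifs <;> omega
  induction l with
  | nil => simp at h
  | cons v l ih =>
    have := key l
    simp only [swapCounts, List.length_cons]
    split_ifs with hv
    · omega
    · have := ih (by simpa [hv] using h)
      omega

/-- The entries of a list in the even and in the odd positions. -/
def unzipAlternate {α : Type*} : List α → List α × List α
  | [] => ([], [])
  | a :: l => (a :: (unzipAlternate l).2, (unzipAlternate l).1)

theorem mem_unzipAlternate {α : Type*} {a : α} {l : List α} (h : a ∈ l) :
    a ∈ (unzipAlternate l).1 ++ (unzipAlternate l).2 := by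
  induction l with
  | nil => simp at h
  | cons b l ih =>
    simp only [List.mem_append, List.mem_cons, unzipAlternate] at h ih ⊢
    tauto

theorem length_unzipAlternate {α : Type*} (l : List α) :
    ((unzipAlternate l).1 ++ (unzipAlternate l).2).length = l.length := by
  induction l with
  | nil => rfl
  | cons b l ih =>
    simp only [List.length_append, List.length_cons, unzipAlternate] at ih ⊢
    omega

/-- When no letter is killed, each section alternates `swap` with the letters of one parity. No
letter is lost, so the sections can be reassembled into a word in the same letters for the shifted
parameters. -/
theorem sections_of_forall_eq_neg_one (w : ℕ → V →* ℤˣ) (l : List V) (h : ∀ v ∈ l, w 0 v = -1) :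
    swap * (sections w l).1 * swap ^ (l.length + 1) =
        word (fun n => w (n + 1)) (unzipAlternate l).1 ∧
      (sections w l).2 * swap ^ l.length = word (fun n => w (n + 1)) (unzipAlternate l).2 := by
  induction l with
  | nil => simp [sections, unzipAlternate]
  | cons v l ih =>
    obtain ⟨h0, h1⟩ := ih fun u hu => h u (List.mem_cons_of_mem _ hu)
    have hv := h v List.mem_cons_self
    constructor
    · simp only [unzipAlternate, word_cons, ← h1, sections, List.length_cons, pow_succ, mul_assoc,
        swap_mul_swap, mul_one]
    · simp only [unzipAlternate, ← h0, sections, List.length_cons, hv, rooted_neg_one]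

theorem swap_pow_of_even {n : ℕ} (h : Even n) : swap ^ n = 1 := by
  obtain ⟨m, rfl⟩ := h
  rw [← two_mul, pow_mul, pow_two, swap_mul_swap, one_pow]

theorem swap_pow_of_odd {n : ℕ} (h : Odd n) : swap ^ n = swap := by
  obtain ⟨m, rfl⟩ := h
  rw [pow_succ, swap_pow_of_even (even_two_mul m), one_mul]

/-- Every element of `V` is killed by infinitely many of the characters `w n`. -/
def KillsAll (w : ℕ → V →* ℤˣ) : Prop := ∀ v, ∀ n, ∃ m, n ≤ m ∧ w m v = 1

theorem KillsAll.shift {w : ℕ → V →* ℤˣ} (h : KillsAll w) : KillsAll fun n => w (n + 1) := by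
  intro v n
  obtain ⟨m, hm, e⟩ := h v (n + 1)
  obtain ⟨m, rfl⟩ := Nat.exists_eq_add_of_le' (show 1 ≤ m by omega)
  exact ⟨m, by omega, e⟩

/-- For even length both sections are shorter. For odd length one squares and considers the product
of the two sections: it is shorter if `w 0` kills a letter; otherwise it is conjugate to a word of
the same length for the shifted parameters, and `n` drops by one. -/
theorem isTwoElement_word_of_lt (k : ℕ)
    (ih : ∀ j < k, ∀ (w : ℕ → V →* ℤˣ) (g : Perm (List Bool)), KillsAll w → HasLength w j g →
      IsTwoElement g)
    (n : ℕ) (w : ℕ → V →* ℤˣ) (l : List V) (hw : KillsAll w) (hl : l.length = k)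
    (hn : ∃ v ∈ l, w n v = 1) : IsTwoElement (word w l) := by
  induction n using Nat.strong_induction_on generalizing w l with
  | _ n ihn =>
  have hk : k ≠ 0 := by
    rintro rfl
    simp [List.length_eq_zero_iff.mp hl] at hn
  have hword := word_eq_node w l
  have hs := sections_hasLength w l
  rcases Nat.even_or_odd l.length with he | ho
  · rw [swap_pow_of_even he, mul_one] at hword
    rw [hword]
    have := swapCounts_le w l
    have := he.two_dvd
    exact IsTwoElement.node (ih _ (by omega) _ _ hw.shift hs.1) (ih _ (by omega) _ _ hw.shift hs.2)
  · rw [swap_pow_of_odd ho] at hword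
    have hsq : word w l ^ 2 = node ((sections w l).1 * (sections w l).2,
        (sections w l).2 * (sections w l).1) := by
      rw [pow_two, hword, ← Prod.mk.eta (p := sections w l)]
      simp only [mul_assoc, swap_mul_node_mul, swap_mul_swap, mul_one, node_mul_node]
    suffices h : IsTwoElement ((sections w l).1 * (sections w l).2) by
      refine IsTwoElement.of_sq ?_
      rw [hsq]
      exact h.node h.mul_comm
    by_cases h0 : ∃ v ∈ l, w 0 v = 1
    · exact ih _ (by simpa [← hl] using swapCounts_add_lt w l h0) _ _ hw.shift (hs.1.mul hs.2)
    · have h1 : ∀ v ∈ l, w 0 v = -1 := fun v hv =>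
        Int.units_ne_iff_eq_neg.mp fun e => h0 ⟨v, hv, e⟩
      obtain ⟨e1, e2⟩ := sections_of_forall_eq_neg_one w l h1
      rw [swap_pow_of_even ho.add_one, mul_one] at e1
      rw [swap_pow_of_odd ho] at e2
      have e3 : word (fun n => w (n + 1)) ((unzipAlternate l).1 ++ (unzipAlternate l).2) =
          swap * ((sections w l).1 * (sections w l).2) * swap⁻¹ := by
        rw [word_append, ← e1, ← e2, swap_inv]
        simp only [mul_assoc]
      rcases n with _ | n
      · exact absurd hn h0
      · have := ihn n (Nat.lt_succ_self n) (fun n => w (n + 1))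
          ((unzipAlternate l).1 ++ (unzipAlternate l).2) hw.shift
          ((length_unzipAlternate l).trans hl)
          (by
            obtain ⟨v, hv, e⟩ := hn
            exact ⟨v, mem_unzipAlternate hv, e⟩)
        rw [e3] at this
        simpa [mul_assoc] using this.conj swap

theorem HasLength.isTwoElement (hV : ∀ v : V, v ^ 2 = 1) (k : ℕ) (w : ℕ → V →* ℤˣ)
    (g : Perm (List Bool)) (hw : KillsAll w) (hg : HasLength w k g) : IsTwoElement g := by
  induction k using Nat.strong_induction_on generalizing w g with
  | _ k ih =>
  obtain ⟨v, l, hl, rfl⟩ := hg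
  rcases hl.lt_or_eq with h | h
  · exact ih _ h _ _ hw ⟨v, l, le_rfl, rfl⟩
  rcases eq_or_ne l [] with rfl | hne
  · refine ⟨1, ?_⟩
    rw [word_nil, mul_one, pow_one, ← map_pow, hV, map_one]
  -- Conjugation moves the leading directed factor to the end, where it is absorbed.
  · refine IsTwoElement.mul_comm ?_
    obtain ⟨l', e, h'⟩ := exists_word_mul_directed w l hne v
    rw [h']
    rcases l' with _ | ⟨u, l'⟩
    · exact absurd (List.length_eq_zero_iff.mp e.symm) hne
    · obtain ⟨n, -, hn⟩ := hw u 0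
      exact isTwoElement_word_of_lt k ih n w _ hw (e.trans h) ⟨u, List.mem_cons_self, hn⟩

/-! ### Comparing two parameters -/

section

variable {V : Type*} [CommGroup V]

/-- `g` and `g'` are given by a common word in `swap` and the directed automorphisms, evaluated for
the parameters `w` and `w'`. -/
inductive Paired (w w' : ℕ → V →* ℤˣ) : Perm (List Bool) → Perm (List Bool) → Prop
  | swap : Paired w w' swap swap
  | directed (v : V) : Paired w w' (directed w v) (directed w' v)
  | one : Paired w w' 1 1
  | mul {g g' h h' : Perm (List Bool)} :
      Paired w w' g g' → Paired w w' h h' → Paired w w' (g * h) (g' * h')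
  | inv {g g' : Perm (List Bool)} : Paired w w' g g' → Paired w w' g⁻¹ g'⁻¹

/-- The commutator `g * h * g⁻¹ * h⁻¹`. -/
def comm {H : Type*} [Group H] (g h : H) : H := g * h * g⁻¹ * h⁻¹

theorem comm_eq_one_iff {H : Type*} [Group H] {g h : H} : comm g h = 1 ↔ g * h = h * g := by
  rw [comm, mul_inv_eq_one, mul_inv_eq_iff_eq_mul]

@[simp] theorem comm_one_left {H : Type*} [Group H] (g : H) : comm 1 g = 1 := by simp [comm]

@[simp] theorem comm_one_right {H : Type*} [Group H] (g : H) : comm g 1 = 1 := by simp [comm]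

theorem comm_node (g h g' h' : Perm (List Bool)) :
    comm (node (g, h)) (node (g', h')) = node (comm g g', comm h h') := by
  simp only [comm, node_inv, node_mul_node]

theorem comm_node_swap_ne_one {h : Perm (List Bool)} (hh : h ≠ 1) :
    comm (node (1, h)) swap ≠ 1 := by
  rw [ne_eq, comm_eq_one_iff, swap_mul_node, mul_left_inj]
  exact fun e => hh (congrArg Prod.snd (node_injective e))

theorem comm_node_swap_ne_one' {h : Perm (List Bool)} (hh : h ≠ 1) :
    comm (node (h, 1)) swap ≠ 1 := by
  rw [ne_eq, comm_eq_one_iff, swap_mul_node, mul_left_inj]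
  exact fun e => hh (congrArg Prod.fst (node_injective e))

variable {w w' : ℕ → V →* ℤˣ} {g g' h h' : Perm (List Bool)}

theorem Paired.comm (hg : Paired w w' g g') (hh : Paired w w' h h') :
    Paired w w' (comm g h) (comm g' h') :=
  ((hg.mul hh).mul hg.inv).mul hh.inv

/-- Every generator one level down is a second section: `swap` occurs in `swap * v * swap`, and a
directed automorphism has its own shift below `true`. -/
theorem Paired.exists_node (h0 : w 0 = w' 0) {v : V} (hv : w 0 v = -1)
    (hg : Paired (fun n => w (n + 1)) (fun n => w' (n + 1)) g g') :
    ∃ p p', Paired w w' (node (p, g)) (node (p', g')) := by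
  have hv' : w' 0 v = -1 := by rw [← h0, hv]
  induction hg with
  | swap =>
    have := (Paired.swap.mul (Paired.directed (w := w) (w' := w') v)).mul Paired.swap
    rw [directed_of_eq_neg_one hv, directed_of_eq_neg_one hv', swap_mul_node, swap_mul_node,
      mul_assoc, mul_assoc, swap_mul_swap, mul_one, mul_one] at this
    exact ⟨_, _, this⟩
  | directed u =>
    refine ⟨rooted (w 0 u), rooted (w' 0 u), ?_⟩
    rw [← directed_eq_node, ← directed_eq_node]
    exact .directed u
  | one => exact ⟨1, 1, by simpa only [node_one] using Paired.one⟩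
  | mul _ _ hx hy =>
    obtain ⟨p, p', hp⟩ := hx
    obtain ⟨q, q', hq⟩ := hy
    exact ⟨p * q, p' * q', by simpa only [node_mul_node] using hp.mul hq⟩
  | inv _ hx =>
    obtain ⟨p, p', hp⟩ := hx
    exact ⟨p⁻¹, p'⁻¹, by simpa only [node_inv] using hp.inv⟩

/-- Some common word acts trivially for the parameters `w`, and for the parameters `w'` acts only
below the vertex `true`, in a way that does not commute with `swap`. -/
def Separated (w w' : ℕ → V →* ℤˣ) : Prop :=
  ∃ h, Paired w w' 1 (node (1, h)) ∧ Wiegold.comm h swap ≠ 1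

/-- The lifted word has an uncontrolled first section. Its commutator with a conjugate of `u`, which
acts only below `true`, removes that section; the conjugation moves the `swap` inside `u` to the
place where `h` acts. -/
theorem Separated.of_shift (h0 : w 0 = w' 0) (hv : ∃ v, w 0 v = -1)
    (hu : ∃ u, w' 0 u = 1 ∧ w' 1 u = -1)
    (h : Separated (fun n => w (n + 1)) (fun n => w' (n + 1))) : Separated w w' := by
  obtain ⟨h, hmem, hne⟩ := h
  obtain ⟨v, hv⟩ := hv
  obtain ⟨u, hu0, hu1⟩ := hu
  obtain ⟨p, p', hp⟩ := hmem.exists_node h0 hv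
  obtain ⟨q, q', hq⟩ := (Paired.swap (w := fun n => w (n + 1))
    (w' := fun n => w' (n + 1))).exists_node h0 hv
  have hc := hp.comm ((hq.mul (.directed u)).mul hq.inv)
  have e1 : directed w u = node (1, directed (fun n => w (n + 1)) u) :=
    directed_of_eq_one (by rw [h0, hu0])
  have e2 : directed w' u = node (1, directed (fun n => w' (n + 1)) u) := directed_of_eq_one hu0
  have e3 : directed (fun n => w' (n + 1)) u = node (swap, directed (fun n => w' (n + 1 + 1)) u) :=
    directed_of_eq_neg_one hu1
  have e4 : swap * directed (fun n => w' (n + 1)) u * swap =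
      node (directed (fun n => w' (n + 1 + 1)) u, swap) := by
    rw [e3, swap_mul_node, mul_assoc, swap_mul_swap, mul_one]
  simp only [e1, e2, node_inv, node_mul_node, mul_one, mul_inv_cancel, comm_node, swap_inv, e4,
    comm_one_left, comm_one_right, node_one] at hc
  exact ⟨_, hc, comm_node_swap_ne_one hne⟩

theorem comm_directed_swap_ne_one {v : V} (hv : w 0 v = -1) :
    Wiegold.comm (directed w v) swap ≠ 1 := by
  rw [ne_eq, comm_eq_one_iff, directed_of_eq_neg_one hv, swap_mul_node, mul_left_inj]
  intro e
  have := congrArg Prod.fst (node_injective e)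
  -- Commuting would force `swap` to equal a directed automorphism, but the latter fixes the first
  -- level.
  rw [directed_eq_node] at this
  simpa using DFunLike.congr_fun this [true]

/-- The word `(swap * v) ^ 4` is trivial when `w 0` kills `v`, but has second section `node (c, c)`
for `w'`, with `c` the second shift of `v`. The commutator with `u` removes the first section and
leaves the commutator of `c` with `swap`. -/
theorem Separated.of_ne (hV : ∀ v : V, v ^ 2 = 1) {v u : V} (hv : w 0 v = 1) (hv0 : w' 0 v = -1)
    (hv1 : w' 1 v = 1) (hv2 : w' 2 v = -1) (hu0 : w' 0 u = 1) (hu1 : w' 1 u = -1) :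
    Separated w w' := by
  have hsq : ∀ (z : ℕ → V →* ℤˣ) (x : V), directed z x * directed z x = 1 := fun z x => by
    rw [← map_mul, ← pow_two, hV, map_one]
  have hg := Paired.swap.mul (Paired.directed (w := w) (w' := w') v)
  have hc := ((hg.mul hg).mul (hg.mul hg)).comm (.directed u)
  have e1 : directed w v = node (1, directed (fun n => w (n + 1)) v) := directed_of_eq_one hv
  have e2 : directed w' v = node (swap, directed (fun n => w' (n + 1)) v) :=
    directed_of_eq_neg_one hv0
  have e3 : directed (fun n => w' (n + 1)) v = node (1, directed (fun n => w' (n + 1 + 1)) v) :=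
    directed_of_eq_one hv1
  have e4 : directed w' u = node (1, directed (fun n => w' (n + 1)) u) := directed_of_eq_one hu0
  have e5 : directed (fun n => w' (n + 1)) u = node (swap, directed (fun n => w' (n + 1 + 1)) u) :=
    directed_of_eq_neg_one hu1
  have e6 : swap * directed w v * (swap * directed w v) *
      (swap * directed w v * (swap * directed w v)) = 1 := by
    rw [e1]
    simp only [mul_assoc, swap_mul_node_mul, swap_mul_node, node_mul_node, mul_one, one_mul, hsq,
      swap_mul_swap, node_one]
  have e7 : ∃ q, swap * directed w' v * (swap * directed w' v) *
      (swap * directed w' v * (swap * directed w' v)) = node (q, node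
        (directed (fun n => w' (n + 1 + 1)) v, directed (fun n => w' (n + 1 + 1)) v)) := by
    refine ⟨directed (fun n => w' (n + 1)) v * swap * (directed (fun n => w' (n + 1)) v * swap), ?_⟩
    rw [e2]
    have : swap * directed (fun n => w' (n + 1)) v * (swap * directed (fun n => w' (n + 1)) v) =
        node (directed (fun n => w' (n + 1 + 1)) v, directed (fun n => w' (n + 1 + 1)) v) := by
      rw [e3]
      simp only [mul_assoc, swap_mul_node_mul, swap_mul_node, node_mul_node, mul_one, one_mul,
        swap_mul_swap]
    rw [← this]
    simp only [mul_assoc, swap_mul_node_mul, swap_mul_node, node_mul_node, mul_one,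
      swap_mul_swap]
  obtain ⟨q, e7⟩ := e7
  have e8 : Wiegold.comm (directed (fun n => w' (n + 1 + 1)) v)
      (directed (fun n => w' (n + 1 + 1)) u) = 1 := by
    rw [comm_eq_one_iff, ← map_mul, ← map_mul, mul_comm]
  rw [e6, e7, comm_one_left, e4, comm_node, comm_one_right, e5, comm_node, e8] at hc
  exact ⟨_, hc, comm_node_swap_ne_one' (comm_directed_swap_ne_one hv2)⟩

end

/-! ### The parameters -/

/-- The group `ℤˣ × ℤˣ` whose nontrivial elements give the directed generators. -/
abbrev Four : Type := ℤˣ × ℤˣ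

theorem four_sq (v : Four) : v ^ 2 = 1 := by
  revert v
  decide

/-- The character of `ℤˣ × ℤˣ` that kills `(-1, 1)`. -/
def chi₀ : Four →* ℤˣ := MonoidHom.snd _ _

/-- The character of `ℤˣ × ℤˣ` that kills `(1, -1)`. -/
def chi₁ : Four →* ℤˣ := MonoidHom.fst _ _

/-- The character of `ℤˣ × ℤˣ` that kills `(-1, -1)`. -/
def chi₂ : Four →* ℤˣ := chi₁ * chi₀

/-- The sequence of characters made of the blocks `chi₀, chi₁, chi₂` and `chi₀, chi₂, chi₁`, chosen
according to the entries of `s`. -/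
def blocks (s : ℕ → Bool) : ℕ → Four →* ℤˣ
  | 0 => chi₀
  | 1 => bif s 0 then chi₁ else chi₂
  | 2 => bif s 0 then chi₂ else chi₁
  | n + 3 => blocks (fun k => s (k + 1)) n

theorem killsAll_blocks (s : ℕ → Bool) : KillsAll (blocks s) := by
  intro v n
  induction n using Nat.strong_induction_on generalizing s with
  | _ n ih =>
  -- The second block, at positions 3 to 5, contains all three characters, and each element is
  -- killed by one of them.
  have h0 : ∀ n ≤ 3, ∃ m, n ≤ m ∧ blocks s m v = 1 := by
    suffices h : ∃ m, 3 ≤ m ∧ blocks s m v = 1 from fun n hn => by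
      obtain ⟨m, hm, e⟩ := h
      exact ⟨m, hn.trans hm, e⟩
    have key : chi₀ v = 1 ∨ chi₁ v = 1 ∨ chi₂ v = 1 := by
      clear ih
      revert v
      decide
    rcases key with h | h | h
    · exact ⟨3, by omega, h⟩
    · cases hs : s 1
      · exact ⟨5, by omega, by simpa [blocks, hs] using h⟩
      · exact ⟨4, by omega, by simpa [blocks, hs] using h⟩
    · cases hs : s 1
      · exact ⟨4, by omega, by simpa [blocks, hs] using h⟩
      · exact ⟨5, by omega, by simpa [blocks, hs] using h⟩
  rcases le_or_gt n 3 with h | h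
  · exact h0 n h
  · obtain ⟨m, hm, e⟩ := ih (n - 3) (by omega) fun k => s (k + 1)
    exact ⟨m + 3, by omega, e⟩

theorem separated_blocks_of_ne {s s' : ℕ → Bool} (h : s 0 ≠ s' 0) :
    Separated (blocks s) (blocks s') := by
  -- Both blocks begin with `chi₀`, so the difference appears only after one shift.
  refine Separated.of_shift rfl ⟨(1, -1), rfl⟩ ?_ ?_
  · cases hs : s' 0
    · exact ⟨(-1, 1), rfl, by simp [blocks, hs]; decide⟩
    · exact ⟨(-1, 1), rfl, by simp [blocks, hs]; decide⟩
  · cases hs : s 0 <;> cases hs' : s' 0 <;> simp only [hs, hs', ne_eq, not_true] at h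
    -- The element `v` is killed by the second character of the block of `s`, and `u` by that of
    -- `s'`.
    · refine Separated.of_ne four_sq (v := (-1, -1)) (u := (1, -1)) ?_ ?_ ?_ ?_ ?_ ?_ <;>
        simp only [blocks, hs, hs', cond_true, cond_false] <;> decide
    · refine Separated.of_ne four_sq (v := (1, -1)) (u := (-1, -1)) ?_ ?_ ?_ ?_ ?_ ?_ <;>
        simp only [blocks, hs, hs', cond_true, cond_false] <;> decide

theorem separated_blocks {s s' : ℕ → Bool} (h : s ≠ s') : Separated (blocks s) (blocks s') := by
  obtain ⟨k, hk⟩ := Function.ne_iff.mp h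
  clear h
  induction k generalizing s s' with
  | zero => exact separated_blocks_of_ne hk
  | succ k ih =>
    by_cases h0 : s 0 = s' 0
    · have hrec : Separated (fun n => blocks s (n + 3)) (fun n => blocks s' (n + 3)) :=
        ih (s := fun k => s (k + 1)) (s' := fun k => s' (k + 1)) hk
      refine Separated.of_shift rfl ⟨(1, -1), rfl⟩ ?_ (Separated.of_shift ?_ ?_ ?_
        (Separated.of_shift ?_ ?_ ?_ hrec)) <;> cases hs' : s' 0 <;>
        simp only [blocks, h0, hs', cond_true, cond_false] <;> decide
    · exact separated_blocks_of_ne h0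

/-! ### The quotients acting on the tree -/

/-- The images of `x` and `y` in the automorphism group of the tree. -/
def treeGen (s : ℕ → Bool) : Fin 2 → Perm (List Bool) :=
  ![directed (blocks s) (-1, -1), swap * directed (blocks s) (-1, 1)]

theorem directed_mul_directed_self (w : ℕ → Four →* ℤˣ) (v : Four) :
    directed w v * directed w v = 1 := by
  rw [← map_mul, ← pow_two, four_sq, map_one]

theorem sq_swap_mul_of_eq_neg_one {w : ℕ → Four →* ℤˣ} {v : Four} (h : w 0 v = -1) :
    (swap * directed w v) ^ 2 = node (directed (fun n => w (n + 1)) v * swap,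
      swap * directed (fun n => w (n + 1)) v) := by
  rw [pow_two, directed_of_eq_neg_one h, swap_mul_node, mul_assoc, swap_mul_node_mul, swap_mul_swap,
    mul_one, node_mul_node]

theorem pow_four_swap_mul_of_eq_one {w : ℕ → Four →* ℤˣ} {v : Four} (h : w 0 v = 1) :
    (swap * directed w v) ^ 4 = 1 := by
  have : (swap * directed w v) ^ 2 = node (directed (fun n => w (n + 1)) v,
      directed (fun n => w (n + 1)) v) := by
    rw [pow_two, directed_of_eq_one h, swap_mul_node, mul_assoc, swap_mul_node_mul, swap_mul_swap,
      mul_one, node_mul_node, one_mul, mul_one]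
  rw [show 4 = 2 * 2 from rfl, pow_mul, this, pow_two, node_mul_node, directed_mul_directed_self,
    node_one]

theorem mul_pow_eq_one_comm {H : Type*} [Group H] {g h : H} {n : ℕ} (e : (g * h) ^ n = 1) :
    (h * g) ^ n = 1 := by
  have : h * g = h * (g * h) * h⁻¹ := by group
  rw [this, conj_pow, e, mul_one, mul_inv_cancel]

/-- The square of `swap * (1, -1)` has sections that are products of `swap` and the shift of `(1,
-1)`. Their fourth powers vanish because `hs` makes the next character `chi₁`, which kills `(1,
-1)`. -/
theorem treeGen_relators (s : ℕ → Bool) (hs : s 0 = true) :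
    ∀ r ∈ relators, FreeGroup.lift (treeGen s) r = 1 := by
  intro r hr
  rcases hr with rfl | rfl | rfl
  · simp only [map_pow, FreeGroup.lift_apply_of]
    change directed (blocks s) (-1, -1) ^ 2 = 1
    rw [pow_two, directed_mul_directed_self]
  · simp only [map_pow, FreeGroup.lift_apply_of]
    exact pow_four_swap_mul_of_eq_one (by rfl)
  · simp only [map_pow, map_mul, FreeGroup.lift_apply_of]
    refine mul_pow_eq_one_comm ?_
    change (swap * directed (blocks s) (-1, 1) * directed (blocks s) (-1, -1)) ^ 8 = 1
    have hc : directed (blocks s) (-1, 1) * directed (blocks s) (-1, -1) =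
        directed (blocks s) (1, -1) := by
      rw [← map_mul]
      rfl
    have h4 : (swap * directed (fun n => blocks s (n + 1)) (1, -1)) ^ 4 = 1 :=
      pow_four_swap_mul_of_eq_one (by simp [blocks, hs]; rfl)
    rw [mul_assoc, hc, show 8 = 2 * 4 from rfl, pow_mul, sq_swap_mul_of_eq_neg_one (by rfl),
      ← map_pow, Prod.pow_mk, h4, mul_pow_eq_one_comm h4]
    exact node_one

/-- A sequence with first entry `true`. -/
def consTrue (s : ℕ → Bool) : ℕ → Bool
  | 0 => true
  | n + 1 => s n

/-- The action of `G` on the tree with parameter `s`. -/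
def treeHom (s : ℕ → Bool) : G →* Perm (List Bool) :=
  PresentedGroup.toGroup (treeGen_relators (consTrue s) rfl)

theorem treeHom_x (s : ℕ → Bool) :
    treeHom s (PresentedGroup.of 0) = directed (blocks (consTrue s)) (-1, -1) :=
  PresentedGroup.toGroup.of _

theorem treeHom_y (s : ℕ → Bool) :
    treeHom s (PresentedGroup.of 1) = swap * directed (blocks (consTrue s)) (-1, 1) :=
  PresentedGroup.toGroup.of _

/-- Induction principle for `G`. -/
theorem G_induction {p : G → Prop} (x : p (PresentedGroup.of 0)) (y : p (PresentedGroup.of 1))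
    (one : p 1) (mul : ∀ g h, p g → p h → p (g * h)) (inv : ∀ g, p g → p g⁻¹) (g : G) : p g := by
  have hg : g ∈ Subgroup.closure (Set.range (PresentedGroup.of (rels := relators))) := by
    rw [PresentedGroup.closure_range_of]
    trivial
  induction hg using Subgroup.closure_induction with
  | mem g hg =>
    obtain ⟨i, rfl⟩ := hg
    fin_cases i
    · exact x
    · exact y
  | one => exact one
  | mul g h _ _ hg hh => exact mul g h hg hh
  | inv g _ hg => exact inv g hg

theorem treeHom_isTwoElement (s : ℕ → Bool) (g : G) : IsTwoElement (treeHom s g) := by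
  suffices h : ∃ k, HasLength (blocks (consTrue s)) k (treeHom s g) by
    obtain ⟨k, hk⟩ := h
    exact hk.isTwoElement four_sq k _ _ (killsAll_blocks _)
  induction g using G_induction with
  | x => exact ⟨_, treeHom_x s ▸ HasLength.directed _ _⟩
  | y => exact ⟨_, treeHom_y s ▸ (HasLength.directed _ _).swap_mul⟩
  | one => exact ⟨0, by rw [map_one]; exact HasLength.one _⟩
  | mul g h hg hh =>
    obtain ⟨j, hj⟩ := hg
    obtain ⟨k, hk⟩ := hh
    exact ⟨j + k, by rw [map_mul]; exact hj.mul hk⟩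
  | inv g hg =>
    obtain ⟨j, hj⟩ := hg
    rw [map_inv]
    exact hj.inv

theorem length_treeHom (s : ℕ → Bool) (g : G) (l : List Bool) :
    (treeHom s g l).length = l.length := by
  have hdir : ∀ (w : ℕ → Four →* ℤˣ) v (l : List Bool), (directed w v l).length = l.length := by
    intro w v l
    induction l generalizing w with
    | nil => rfl
    | cons b l ih =>
      rw [directed_eq_node]
      cases b
      · rw [node_false, List.length_cons, List.length_cons]
        rcases Int.units_eq_one_or (w 0 v) with h | h
        · rw [h, map_one]
          rfl
        · rw [h, rooted_neg_one]
          cases l <;> rfl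
      · rw [node_true, List.length_cons, List.length_cons, ih]
  have hswap : ∀ l : List Bool, (swap l).length = l.length := by
    intro l
    cases l <;> rfl
  induction g using G_induction generalizing l with
  | x => rw [treeHom_x, hdir]
  | y => rw [treeHom_y, Equiv.Perm.mul_apply, hswap, hdir]
  | one => rw [map_one, Equiv.Perm.one_apply]
  | mul g h hg hh => rw [map_mul, Equiv.Perm.mul_apply, hg, hh]
  | inv g hg =>
    rw [map_inv, ← hg, ← Equiv.Perm.mul_apply, mul_inv_cancel, Equiv.Perm.one_apply]

theorem exists_conj_treeHom {q : (ℕ → Bool) → Perm (List Bool)}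
    (hx : ∃ h, ∀ s, treeHom s h = q s * treeHom s (.of 0) * (q s)⁻¹)
    (hy : ∃ h, ∀ s, treeHom s h = q s * treeHom s (.of 1) * (q s)⁻¹) (g : G) :
    ∃ h, ∀ s, treeHom s h = q s * treeHom s g * (q s)⁻¹ := by
  induction g using G_induction with
  | x => exact hx
  | y => exact hy
  | one => exact ⟨1, fun s => by simp⟩
  | mul g g' hg hg' =>
    obtain ⟨h, hh⟩ := hg
    obtain ⟨h', hh'⟩ := hg'
    exact ⟨h * h', fun s => by simp [hh, hh', mul_assoc]⟩
  | inv g hg =>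
    obtain ⟨h, hh⟩ := hg
    exact ⟨h⁻¹, fun s => by simp [hh, mul_assoc]⟩

theorem mem_normalizer_range_treeHom {q : (ℕ → Bool) → Perm (List Bool)} (hq : ∀ s, q s * q s = 1)
    (hx : ∃ h, ∀ s, treeHom s h = q s * treeHom s (.of 0) * (q s)⁻¹)
    (hy : ∃ h, ∀ s, treeHom s h = q s * treeHom s (.of 1) * (q s)⁻¹) (s s' : ℕ → Bool) :
    (q s, q s') ∈ Subgroup.normalizer (((treeHom s).prod (treeHom s')).range : Set _) := by
  have key : ∀ r ∈ ((treeHom s).prod (treeHom s')).range,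
      (q s, q s') * r * (q s, q s')⁻¹ ∈ ((treeHom s).prod (treeHom s')).range := by
    rintro _ ⟨g, rfl⟩
    obtain ⟨h, hh⟩ := exists_conj_treeHom hx hy g
    exact ⟨h, Prod.ext (hh s) (hh s')⟩
  have hinv : (q s, q s')⁻¹ = (q s, q s') :=
    inv_eq_of_mul_eq_one_left (Prod.ext (hq s) (hq s'))
  rw [Subgroup.mem_normalizer_iff]
  refine fun r => ⟨key r, fun hr => ?_⟩
  have := key _ hr
  have hqq : (q s, q s') * (q s, q s') = 1 := Prod.ext (hq s) (hq s')
  rwa [hinv, mul_assoc, mul_assoc, mul_assoc, hqq, mul_one, ← mul_assoc, hqq, one_mul] at this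

/-- A conjugate of the image of `G` by a common word is again in the image of `G`. -/
theorem exists_conj_treeHom_of_paired {s s' : ℕ → Bool} {p p' : Perm (List Bool)}
    (hp : Paired (blocks (consTrue s)) (blocks (consTrue s')) p p') (g : G) :
    ∃ h : G, treeHom s h = p * treeHom s g * p⁻¹ ∧ treeHom s' h = p' * treeHom s' g * p'⁻¹ := by
  have hinv : ∀ (w : ℕ → Four →* ℤˣ) v, (directed w v)⁻¹ = directed w v := fun w v =>
    inv_eq_of_mul_eq_one_left (directed_mul_directed_self w v)
  have hcomm : ∀ w : ℕ → Four →* ℤˣ, directed w (-1, 1) * directed w (-1, -1) =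
      directed w (-1, -1) * directed w (-1, 1) := fun w => by
    rw [← map_mul, ← map_mul, mul_comm]
  -- This element commutes with the image of `x` and inverts the image of `y`.
  have hd : (directed (blocks (consTrue s)) (-1, 1), directed (blocks (consTrue s')) (-1, 1)) ∈
      Subgroup.normalizer (((treeHom s).prod (treeHom s')).range : Set _) := by
    refine mem_normalizer_range_treeHom (q := fun s => directed (blocks (consTrue s)) (-1, 1))
      (fun _ => directed_mul_directed_self _ _) ⟨.of 0, fun t => ?_⟩ ⟨(.of 1)⁻¹, fun t => ?_⟩ s s'
    · rw [treeHom_x, hcomm, mul_inv_cancel_right]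
    · rw [map_inv, treeHom_y, mul_inv_rev, mul_assoc, hinv, swap_inv, mul_assoc,
        directed_mul_directed_self, mul_one]
  have hb : (directed (blocks (consTrue s)) (-1, -1), directed (blocks (consTrue s')) (-1, -1)) ∈
      Subgroup.normalizer (((treeHom s).prod (treeHom s')).range : Set _) :=
    Subgroup.le_normalizer ⟨.of 0, Prod.ext (treeHom_x s) (treeHom_x s')⟩
  have hp' : (p, p') ∈ Subgroup.normalizer (((treeHom s).prod (treeHom s')).range : Set _) := by
    induction hp with
    | swap =>
      -- Conjugation by `swap` takes `x` to `y * x * y⁻¹` and inverts `y`.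
      refine mem_normalizer_range_treeHom (q := fun _ => swap)
        (fun _ => swap_mul_swap) ⟨.of 1 * .of 0 * (.of 1)⁻¹, fun t => ?_⟩
        ⟨(.of 1)⁻¹, fun t => ?_⟩ s s'
      · rw [map_mul, map_mul, map_inv, treeHom_x, treeHom_y, mul_inv_rev, mul_assoc swap,
          hcomm]
        simp only [mul_assoc, mul_inv_cancel_left]
      · rw [map_inv, treeHom_y, mul_inv_rev, swap_mul_swap_mul, hinv]
    | directed v =>
      have hv : v = 1 ∨ v = (-1, 1) ∨ v = (-1, -1) ∨ v = (-1, 1) * (-1, -1) := by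
        revert v
        decide
      rcases hv with rfl | rfl | rfl | rfl
      · rw [map_one, map_one]
        exact one_mem _
      · exact hd
      · exact hb
      · have := mul_mem hd hb
        rwa [Prod.mk_mul_mk, ← map_mul (directed (blocks (consTrue s))),
          ← map_mul (directed (blocks (consTrue s')))] at this
    | one => exact one_mem _
    | mul _ _ h h' => exact mul_mem h h'
    | inv _ h => exact inv_mem h
  obtain ⟨h, hh⟩ := (Subgroup.mem_normalizer_iff.mp hp' (treeHom s g, treeHom s' g)).mp ⟨g, rfl⟩
  exact ⟨h, congrArg Prod.fst hh, congrArg Prod.snd hh⟩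

theorem consTrue_injective : Function.Injective consTrue := fun _ _ h =>
  funext fun n => congrFun h (n + 1)

/-- If `f` is the conjugate of `g` by a separating word, then `f * g⁻¹` is trivial for `s`. For `s'`
it is the commutator of `node (1, h)` with `node (q, swap)`, which is nontrivial. -/
theorem ker_treeHom_injective : Function.Injective fun s => (treeHom s).ker := by
  intro s s' e
  by_contra hne
  obtain ⟨h, hp, hc⟩ := separated_blocks (consTrue_injective.ne hne)
  obtain ⟨g, hg⟩ : ∃ g : G, ∀ t, ∃ q, treeHom t g = node (q, swap) := by
    refine ⟨.of 1 * .of 0 * (.of 1)⁻¹, fun t => ?_⟩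
    refine ⟨directed (fun n => blocks (consTrue t) (n + 1)) (-1, -1), ?_⟩
    have hcomm : directed (blocks (consTrue t)) (-1, 1) * directed (blocks (consTrue t)) (-1, -1) =
        directed (blocks (consTrue t)) (-1, -1) * directed (blocks (consTrue t)) (-1, 1) := by
      rw [← map_mul, ← map_mul, mul_comm]
    have h0 : directed (blocks (consTrue t)) (-1, -1) =
        node (swap, directed (fun n => blocks (consTrue t) (n + 1)) (-1, -1)) :=
      directed_of_eq_neg_one (by rfl)
    rw [map_mul, map_mul, map_inv, treeHom_x, treeHom_y, mul_inv_rev, mul_assoc swap, hcomm,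
      mul_assoc, mul_assoc, mul_inv_cancel_left, swap_inv, h0, swap_mul_node_mul, swap_mul_swap,
      mul_one]
  obtain ⟨q, hq⟩ := hg s'
  obtain ⟨f, hf, hf'⟩ := exists_conj_treeHom_of_paired hp g
  have h1 : f * g⁻¹ ∈ (treeHom s).ker := by
    rw [MonoidHom.mem_ker, map_mul, map_inv, hf]
    simp
  have e' : (treeHom s).ker = (treeHom s').ker := e
  have h2 : f * g⁻¹ ∈ (treeHom s').ker := e' ▸ h1
  rw [MonoidHom.mem_ker, map_mul, map_inv, hf', hq] at h2
  refine hc ?_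
  have := (comm_node 1 h q swap).symm.trans h2
  rw [← node_one] at this
  exact congrArg Prod.snd (node_injective this)

open RegularWreathProduct

/-! ### Homomorphisms to wreath products -/

/-- The cyclic group of order four. -/
abbrev C₄ : Type := Multiplicative (ZMod 4)

/-- A generator of the cyclic group of order four. -/
def rot : C₄ := Multiplicative.ofAdd 1

theorem of_zero_sq : (PresentedGroup.of 0 : G) ^ 2 = 1 :=
  PresentedGroup.one_of_mem (rels := relators) (Or.inl rfl)

theorem of_one_pow_four : (PresentedGroup.of 1 : G) ^ 4 = 1 :=
  PresentedGroup.one_of_mem (rels := relators) (Or.inr (Or.inl rfl))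

instance : E.Normal := Subgroup.normalClosure_normal

/-- Inverses need no separate hypothesis, because both generators have finite order. -/
theorem G_induction_left {M : Type*} [Group M] (π : G →* M) {S : Set M} (one : 1 ∈ S)
    (x : ∀ z ∈ S, π (.of 0) * z ∈ S) (y : ∀ z ∈ S, π (.of 1) * z ∈ S) (g : G) : π g ∈ S := by
  suffices h : ∀ z, z ∈ S ↔ π g * z ∈ S by simpa using (h 1).mp one
  induction g using G_induction with
  | x =>
    refine fun z => ⟨x z, fun h => ?_⟩
    have h' := x _ h
    rwa [← mul_assoc, ← map_mul, ← pow_two, of_zero_sq, map_one, one_mul] at h'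
  | y =>
    refine fun z => ⟨y z, fun h => ?_⟩
    have e : π (.of 1) * (π (.of 1) * (π (.of 1) * (π (.of 1) * z))) = z := by
      have := congrArg π of_one_pow_four
      rw [map_pow, map_one, pow_succ, pow_succ, pow_two] at this
      rw [← mul_assoc, ← mul_assoc, ← mul_assoc, this, one_mul]
    have h' := y _ (y _ (y _ h))
    rwa [e] at h'
  | one => simp
  | mul g h hg hh =>
    intro z
    rw [hh, hg, map_mul, mul_assoc]
  | inv g hg =>
    intro z
    rw [hg (π g⁻¹ * z), map_inv, mul_inv_cancel_left]

section

variable {B : Type*} [Group B]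

/-- The fourth power of `x * y` lies in the base group, its coordinates being the products of `f`
around the cycle. -/
theorem wreath_relators (f : C₄ → B) (h2 : ∀ k, f k * f k = 1)
    (h8 : ∀ k, (f k * f (rot⁻¹ * k) * f (rot⁻¹ * (rot⁻¹ * k)) *
      f (rot⁻¹ * (rot⁻¹ * (rot⁻¹ * k)))) ^ 2 = 1) :
    ∀ r ∈ relators, FreeGroup.lift (![⟨f, 1⟩, inl rot] : Fin 2 → B ≀ᵣ C₄) r = 1 := by
  have h4 : rot ^ 4 = 1 := rfl
  have h4' : ∀ k : C₄, rot⁻¹ * (rot⁻¹ * (rot⁻¹ * (rot⁻¹ * k))) = k := by decide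
  intro r hr
  rcases hr with rfl | rfl | rfl
  · simp only [map_pow, FreeGroup.lift_apply_of]
    ext k
    · simpa [pow_two] using h2 k
    · simp [pow_two]
  · simp only [map_pow, FreeGroup.lift_apply_of]
    change inl rot ^ 4 = 1
    rw [← map_pow, h4, map_one]
  · simp only [map_pow, map_mul, FreeGroup.lift_apply_of]
    have e : (⟨f, 1⟩ * inl rot : B ≀ᵣ C₄) = ⟨f, rot⟩ := by ext <;> simp
    change (⟨f, 1⟩ * inl rot : B ≀ᵣ C₄) ^ 8 = 1
    rw [e, show 8 = 4 * 2 from rfl, pow_mul]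
    have e4 : (⟨f, rot⟩ : B ≀ᵣ C₄) ^ 4 = ⟨fun k => f k * f (rot⁻¹ * k) *
        f (rot⁻¹ * (rot⁻¹ * k)) * f (rot⁻¹ * (rot⁻¹ * (rot⁻¹ * k))), 1⟩ := by
      rw [pow_succ, pow_succ, pow_two]
      ext k
      · simp [mul_assoc]
      · exact h4
    rw [e4]
    ext k
    · simpa [pow_two] using h8 k
    · simp [pow_two]

/-- A homomorphism from `G` to the wreath product of `B` with the cyclic group of order four. -/
def wreathHom (f : C₄ → B) (h2 : ∀ k, f k * f k = 1)
    (h8 : ∀ k, (f k * f (rot⁻¹ * k) * f (rot⁻¹ * (rot⁻¹ * k)) *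
      f (rot⁻¹ * (rot⁻¹ * (rot⁻¹ * k)))) ^ 2 = 1) : G →* B ≀ᵣ C₄ :=
  PresentedGroup.toGroup (wreath_relators f h2 h8)

variable {f : C₄ → B} {h2 : ∀ k, f k * f k = 1}
  {h8 : ∀ k, (f k * f (rot⁻¹ * k) * f (rot⁻¹ * (rot⁻¹ * k)) *
      f (rot⁻¹ * (rot⁻¹ * (rot⁻¹ * k)))) ^ 2 = 1}

theorem wreathHom_x : wreathHom f h2 h8 (.of 0) = ⟨f, 1⟩ :=
  PresentedGroup.toGroup.of _

theorem wreathHom_y : wreathHom f h2 h8 (.of 1) = inl rot :=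
  PresentedGroup.toGroup.of _

theorem wreathHom_conj (j : ℕ) :
    wreathHom f h2 h8 (.of 1 ^ j * .of 0 * (.of 1 ^ j)⁻¹) = ⟨fun k => f ((rot ^ j)⁻¹ * k), 1⟩ := by
  rw [map_mul, map_mul, map_inv, map_pow, wreathHom_x, wreathHom_y, ← map_pow inl]
  ext k <;> simp [-map_pow]

theorem toProd_x : toProd (.of 0) = (Multiplicative.ofAdd 1, 1) := PresentedGroup.toGroup.of _

theorem toProd_y : toProd (.of 1) = (1, Multiplicative.ofAdd 1) := PresentedGroup.toGroup.of _

theorem wreathHom_right (g : G) : (wreathHom f h2 h8 g).right = (toProd g).2 := by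
  induction g using G_induction with
  | x => rw [wreathHom_x, toProd_x]
  | y =>
    rw [wreathHom_y, toProd_y]
    rfl
  | one => simp
  | mul g h hg hh => simp [hg, hh]
  | inv g hg => simp [hg]

theorem wreathHom_map {A : Type*} [Group A] (φ : B →* A) {h2' : ∀ k, φ (f k) * φ (f k) = 1}
    {h8' : ∀ k, (φ (f k) * φ (f (rot⁻¹ * k)) * φ (f (rot⁻¹ * (rot⁻¹ * k))) *
      φ (f (rot⁻¹ * (rot⁻¹ * (rot⁻¹ * k))))) ^ 2 = 1} (g : G) (k : C₄) :
    (wreathHom (fun k => φ (f k)) h2' h8' g).left k = φ ((wreathHom f h2 h8 g).left k) := by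
  induction g using G_induction generalizing k with
  | x => rw [wreathHom_x, wreathHom_x]
  | y => simp [wreathHom_y]
  | one => simp
  | mul g h hg hh => simp [hg, hh, wreathHom_right]
  | inv g hg => simp [hg, wreathHom_right]

end

/-- An element of `toProd.ker` lands in the base group, which has exponent two. -/
theorem E_le_ker_wreathHom {A : Type*} [CommGroup A] (hA : ∀ a : A, a ^ 2 = 1) {f : C₄ → A}
    {h2 : ∀ k, f k * f k = 1}
    {h8 : ∀ k, (f k * f (rot⁻¹ * k) * f (rot⁻¹ * (rot⁻¹ * k)) *
      f (rot⁻¹ * (rot⁻¹ * (rot⁻¹ * k)))) ^ 2 = 1} : E ≤ (wreathHom f h2 h8).ker := by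
  refine Subgroup.normalClosure_le_normal ?_
  rintro _ ⟨b, hb, rfl⟩
  have hr : (wreathHom f h2 h8 b).right = 1 := by
    rw [wreathHom_right, MonoidHom.mem_ker.mp hb, Prod.snd_one]
  rw [SetLike.mem_coe, MonoidHom.mem_ker, map_pow, pow_two]
  ext k
  · simpa [hr, pow_two] using hA _
  · simp [hr]

/-! ### The index of `E` -/

/-- The homomorphism from `G` onto the wreath product of cyclic groups of orders two and four. -/
def signWreathHom : G →* ℤˣ ≀ᵣ C₄ :=
  wreathHom (Pi.mulSingle 1 (-1)) (by decide) (by decide)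

/-- The conjugates of `x` by powers of `y` give a single sign at each coordinate. -/
theorem signWreathHom_surjective : Function.Surjective signWreathHom := by
  let ι : (C₄ → ℤˣ) →* ℤˣ ≀ᵣ C₄ :=
    { toFun := fun g => ⟨g, 1⟩
      map_one' := rfl
      map_mul' := fun g h => by ext <;> simp }
  have hrot : ∀ q : C₄, ∃ j : ℕ, rot ^ j = q := fun q => ⟨(Multiplicative.toAdd q).val, by
    revert q
    decide⟩
  have hι : ∀ g, g ∈ signWreathHom.range.comap ι := by
    intro g
    refine Subgroup.pi_mem_of_mulSingle_mem g fun q => ?_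
    rcases Int.units_eq_one_or (g q) with h | h
    · rw [h, Pi.mulSingle_one]
      exact one_mem _
    · rw [h]
      obtain ⟨j, rfl⟩ := hrot q
      refine ⟨_, (wreathHom_conj j).trans ?_⟩
      ext k
      · simp only [ι, Pi.mulSingle_apply, MonoidHom.coe_mk, OneHom.coe_mk, inv_mul_eq_one, eq_comm]
      · rfl
  intro s
  obtain ⟨j, hj⟩ := hrot s.right
  obtain ⟨g, hg⟩ := hι s.left
  refine ⟨g * .of 1 ^ j, ?_⟩
  rw [map_mul, hg, map_pow]
  change _ * (wreathHom _ _ _ _) ^ j = _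
  rw [wreathHom_y, ← map_pow inl, hj]
  ext k <;> simp [ι]

theorem dvd_index_E : 2 ^ 6 ∣ E.index := by
  have h : signWreathHom.ker.index = 2 ^ 6 := by
    rw [Subgroup.index_ker, MonoidHom.range_eq_top.mpr signWreathHom_surjective,
      Subgroup.card_top, RegularWreathProduct.card]
    simp [Nat.card_eq_fintype_card]
  rw [← h]
  exact Subgroup.index_dvd_of_le (E_le_ker_wreathHom (fun a => Int.units_sq a))

/-- The conjugate of `x` by the `i`-th power of `y`. -/
def xConj (i : ℕ) : G := .of 1 ^ i * .of 0 * (.of 1 ^ i)⁻¹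

theorem xConj_sq (i : ℕ) : xConj i ^ 2 = 1 := by
  rw [xConj, conj_pow, of_zero_sq, mul_one, mul_inv_cancel]

theorem y_mul_xConj (i : ℕ) : .of 1 * xConj i = xConj (i + 1) * .of 1 := by
  simp only [xConj, pow_succ' _ i, mul_inv_rev, mul_assoc, inv_mul_cancel, mul_one]

theorem xConj_mul_xConj_sq_mem_E (i j : ℕ) : (xConj i * xConj j) ^ 2 ∈ E := by
  refine Subgroup.subset_normalClosure ⟨_, ?_, rfl⟩
  have h : ∀ i, toProd (xConj i) = (Multiplicative.ofAdd 1, 1) := fun i => by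
    rw [xConj, map_mul, map_mul, map_inv, mul_inv_cancel_comm, toProd_x]
  rw [MonoidHom.mem_ker, map_mul, h, h]
  decide

theorem exists_eq_mul_pow {M : Type*} [Group M] (π : G →* M) (hπ : Function.Surjective π)
    (hc : ∀ i j, Commute (π (xConj i)) (π (xConj j))) (g : M) : ∃ a b c d m : ℕ,
    g = π (xConj 0) ^ a * π (xConj 1) ^ b * π (xConj 2) ^ c * π (xConj 3) ^ d * π (.of 1) ^ m := by
  obtain ⟨g, rfl⟩ := hπ g
  refine G_induction_left π (S := {g | ∃ a b c d m : ℕ, g = π (xConj 0) ^ a * π (xConj 1) ^ b *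
    π (xConj 2) ^ c * π (xConj 3) ^ d * π (.of 1) ^ m}) ⟨0, 0, 0, 0, 0, by simp⟩ ?_ ?_ g
  · rintro _ ⟨a, b, c, d, m, rfl⟩
    exact ⟨a + 1, b, c, d, m, by simp [pow_succ', mul_assoc, xConj]⟩
  · rintro _ ⟨a, b, c, d, m, rfl⟩
    have hy : ∀ i k z, π (.of 1) * (π (xConj i) ^ k * z) =
        π (xConj (i + 1)) ^ k * (π (.of 1) * z) := by
      intro i k z
      induction k with
      | zero => simp
      | succ k ih =>
        rw [pow_succ', mul_assoc, ← mul_assoc (π (.of 1)), ← map_mul, y_mul_xConj, map_mul,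
          mul_assoc, ih, pow_succ', mul_assoc]
    have h4 : xConj 4 = xConj 0 := by simp [xConj, of_one_pow_four]
    -- Moving `y` to the right rotates the exponents cyclically.
    refine ⟨d, a, b, c, m + 1, ?_⟩
    simp only [mul_assoc, hy, Nat.reduceAdd, h4, pow_succ' _ m]
    have hcc : Commute (π (xConj 1) ^ a * π (xConj 2) ^ b * π (xConj 3) ^ c) (π (xConj 0) ^ d) :=
      (((hc 1 0).pow_pow a d).mul_left ((hc 2 0).pow_pow b d)).mul_left ((hc 3 0).pow_pow c d)
    simp only [← mul_assoc]
    rw [hcc.eq]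
    simp only [← mul_assoc]

theorem card_le_of_commute {M : Type*} [Group M] (π : G →* M) (hπ : Function.Surjective π)
    (hc : ∀ i j, Commute (π (xConj i)) (π (xConj j))) : Finite M ∧ Nat.card M ≤ 2 ^ 6 := by
  let F : (Fin 2 × Fin 2 × Fin 2 × Fin 2) × Fin 4 → M := fun t =>
    π (xConj 0) ^ (t.1.1 : ℕ) * π (xConj 1) ^ (t.1.2.1 : ℕ) * π (xConj 2) ^ (t.1.2.2.1 : ℕ) *
      π (xConj 3) ^ (t.1.2.2.2 : ℕ) * π (.of 1) ^ (t.2 : ℕ)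
  have hF : Function.Surjective F := by
    intro g
    obtain ⟨a, b, c, d, m, rfl⟩ := exists_eq_mul_pow π hπ hc g
    have hx : ∀ i, π (xConj i) ^ 2 = 1 := fun i => by rw [← map_pow, xConj_sq, map_one]
    have hy : π (.of 1) ^ 4 = 1 := by rw [← map_pow, of_one_pow_four, map_one]
    refine ⟨((Fin.ofNat 2 a, Fin.ofNat 2 b, Fin.ofNat 2 c, Fin.ofNat 2 d), Fin.ofNat 4 m), ?_⟩
    simp only [F, Fin.val_ofNat, ← pow_eq_pow_mod _ (hx _), ← pow_eq_pow_mod _ hy]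
  refine ⟨Finite.of_surjective F hF, (Nat.card_le_card_of_surjective F hF).trans ?_⟩
  simp [Nat.card_eq_fintype_card]

theorem index_E : E.index = 2 ^ 6 := by
  obtain ⟨hfin, hle⟩ := card_le_of_commute (QuotientGroup.mk' E)
    (QuotientGroup.mk'_surjective E) (by
    intro i j
    have h2 : ∀ i, QuotientGroup.mk' E (xConj i) * QuotientGroup.mk' E (xConj i) = 1 := fun i => by
      rw [← map_mul, ← pow_two, xConj_sq, map_one]
    have h := (QuotientGroup.eq_one_iff _).mpr (xConj_mul_xConj_sq_mem_E i j)
    have h' : (QuotientGroup.mk' E (xConj i) * QuotientGroup.mk' E (xConj j)) *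
        (QuotientGroup.mk' E (xConj i) * QuotientGroup.mk' E (xConj j)) = 1 := by
      rw [← pow_two, ← map_mul, ← map_pow]
      exact h
    have hinv : ∀ i, (QuotientGroup.mk' E (xConj i))⁻¹ = QuotientGroup.mk' E (xConj i) := fun i =>
      inv_eq_of_mul_eq_one_left (h2 i)
    rw [commute_iff_eq, eq_inv_of_mul_eq_one_left h', mul_inv_rev, hinv, hinv])
  have hpos : 0 < E.index := Nat.card_pos
  exact le_antisymm hle (Nat.le_of_dvd hpos dvd_index_E)

/-! ### A free quotient of `E` -/

/-- The homomorphism from `ℤˣ` that sends `-1` to a given involution. -/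
def involutionHom {M : Type*} [Group M] (σ : M) (hσ : σ * σ = 1) : ℤˣ →* M where
  toFun u := if u = 1 then 1 else σ
  map_one' := rfl
  map_mul' u v := by
    rcases Int.units_eq_one_or u with rfl | rfl <;> rcases Int.units_eq_one_or v with rfl | rfl <;>
      simp [hσ]

theorem involutionHom_neg_one {M : Type*} [Group M] (σ : M) (hσ : σ * σ = 1) :
    involutionHom σ hσ (-1) = σ := rfl

/-- The automorphism of the free group of rank two that exchanges the generators. -/
def exchange : MulAut (FreeGroup Bool) := FreeGroup.freeGroupCongr Equiv.boolNot

/-- The automorphism of the free group of rank two that inverts both generators. -/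
def invert : MulAut (FreeGroup Bool) :=
  MonoidHom.toMulEquiv (FreeGroup.lift fun b => (FreeGroup.of b)⁻¹)
    (FreeGroup.lift fun b => (FreeGroup.of b)⁻¹) (by ext; simp) (by ext; simp)

theorem exchange_of (b : Bool) : exchange (.of b) = .of !b := by
  simp [exchange]

theorem invert_of (b : Bool) : invert (.of b) = (.of b)⁻¹ := by
  simp [invert]

theorem mulAut_freeGroup_ext {φ ψ : MulAut (FreeGroup Bool)} (h : ∀ b, φ (.of b) = ψ (.of b)) :
    φ = ψ :=
  MulEquiv.toMonoidHom_injective (FreeGroup.ext_hom _ _ h)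

theorem exchange_mul_exchange : exchange * exchange = 1 :=
  mulAut_freeGroup_ext fun b => by simp [exchange_of]

theorem invert_mul_invert : invert * invert = 1 :=
  mulAut_freeGroup_ext fun b => by simp [invert_of]

theorem commute_exchange_invert : Commute exchange invert :=
  mulAut_freeGroup_ext fun b => by simp [exchange_of, invert_of]

/-- The action of the four-group on the free group of rank two. -/
def fourAction : Four →* MulAut (FreeGroup Bool) :=
  (involutionHom exchange exchange_mul_exchange).noncommCoprod
    (involutionHom invert invert_mul_invert) fun u v => by
      rcases Int.units_eq_one_or u with rfl | rfl <;>
        rcases Int.units_eq_one_or v with rfl | rfl <;>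
        simp [involutionHom_neg_one, commute_exchange_invert]

theorem fourAction_fst : fourAction (-1, 1) = exchange := by
  simp [fourAction, involutionHom_neg_one]

theorem fourAction_snd : fourAction (1, -1) = invert := by
  simp [fourAction, involutionHom_neg_one]

/-- The extension of the free group of rank two by the four-group. -/
abbrev FreeByFour : Type := FreeGroup Bool ⋊[fourAction] Four

/-- The images in `FreeByFour` of the conjugates of `x` by the powers of `y`. -/
def freeGen : C₄ → FreeByFour := fun k =>
  ![.inr (-1, 1), .inr (1, -1), .inr (1, -1) * .inl (.of true), .inr (1, -1) * .inl (.of true)]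
    (Multiplicative.toAdd k)

theorem C₄_cases (k : C₄) : k = 1 ∨ k = rot ∨ k = rot ^ 2 ∨ k = rot ^ 3 := by
  revert k
  decide

theorem inr_mul_inr_self (v : Four) : (.inr v * .inr v : FreeByFour) = 1 := by
  rw [← map_mul, ← pow_two, four_sq, map_one]

theorem inr_mul_inl_mul_self :
    (.inr (1, -1) * .inl (.of true) * (.inr (1, -1) * .inl (.of true)) : FreeByFour) = 1 := by
  ext1
  · simp [fourAction_snd, invert_of]
  · simp

theorem freeGen_sq (k : C₄) : freeGen k * freeGen k = 1 := by
  rcases C₄_cases k with rfl | rfl | rfl | rfl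
  · exact inr_mul_inr_self _
  · exact inr_mul_inr_self _
  · exact inr_mul_inl_mul_self
  · exact inr_mul_inl_mul_self

/-- The two equal involutions `c` are adjacent and cancel, up to conjugation by `c` in one rotation.
What remains is a product of two elements of the four-group. -/
theorem freeGen_relator (k : C₄) : (freeGen k * freeGen (rot⁻¹ * k) *
    freeGen (rot⁻¹ * (rot⁻¹ * k)) * freeGen (rot⁻¹ * (rot⁻¹ * (rot⁻¹ * k)))) ^ 2 = 1 := by
  have key : ∀ a b c : FreeByFour, c * c = 1 → (a * b) ^ 2 = 1 →
      (a * c * c * b) ^ 2 = 1 ∧ (b * a * c * c) ^ 2 = 1 ∧ (c * b * a * c) ^ 2 = 1 ∧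
        (c * c * b * a) ^ 2 = 1 := by
    intro a b c hc hab
    have hba := mul_pow_eq_one_comm hab
    have hc' : c = c⁻¹ := eq_inv_of_mul_eq_one_left hc
    refine ⟨by rwa [mul_assoc a, hc, mul_one], by rwa [mul_assoc (b * a), hc, mul_one], ?_,
      by rwa [hc, one_mul]⟩
    nth_rw 2 [hc']
    rw [mul_assoc c, conj_pow, hba, mul_one, mul_inv_cancel]
  obtain ⟨h0, h1, h2, h3⟩ := key (.inr (-1, 1)) (.inr (1, -1)) _ inr_mul_inl_mul_self
    (by rw [← map_mul, ← map_pow, four_sq, map_one])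
  rcases C₄_cases k with rfl | rfl | rfl | rfl
  · exact h0
  · exact h1
  · exact h2
  · exact h3

/-- The homomorphism from `G` to a wreath product of a virtually free group. -/
def freeWreathHom : G →* FreeByFour ≀ᵣ C₄ := wreathHom freeGen freeGen_sq freeGen_relator

/-- Projecting the base to the four-group gives a wreath homomorphism that kills `E`. -/
theorem freeWreathHom_right {g : G} (hg : g ∈ E) (k : C₄) :
    ((freeWreathHom g).left k).right = 1 := by
  have h := E_le_ker_wreathHom four_sq (f := fun k => SemidirectProduct.rightHom (freeGen k))
    (h2 := fun k => by rw [← map_mul, freeGen_sq, map_one])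
    (h8 := fun k => by simp only [← map_mul, ← map_pow, freeGen_relator, map_one]) hg
  rw [MonoidHom.mem_ker] at h
  have h' := congrFun (congrArg RegularWreathProduct.left h) k
  rwa [wreathHom_map (h2 := freeGen_sq) (h8 := freeGen_relator)] at h'

theorem E_le_ker_toProd : E ≤ toProd.ker := by
  refine Subgroup.normalClosure_le_normal ?_
  rintro _ ⟨b, hb, rfl⟩
  exact pow_mem hb 2

/-- A homomorphism from `E` to the free group of rank two. -/
def freeHom : E →* FreeGroup Bool where
  toFun e := ((freeWreathHom e).left 1).left
  map_one' := by simp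
  map_mul' e e' := by
    have h : (freeWreathHom e).right = 1 := by
      rw [freeWreathHom, wreathHom_right, MonoidHom.mem_ker.mp (E_le_ker_toProd e.2), Prod.snd_one]
    simp [h, freeWreathHom_right e.2]

/-- The image contains the squares of both free generators: one from `(xConj 3 * xConj 1) ^ 2`, the
other from its conjugate by `xConj 0`, which acts at this coordinate as `exchange`. -/
theorem freeHom_noncomm : ∃ e e' : E, freeHom e * freeHom e' ≠ freeHom e' * freeHom e := by
  have hx : ∀ j, freeWreathHom (xConj j) = ⟨fun k => freeGen ((rot ^ j)⁻¹ * k), 1⟩ := fun j =>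
    wreathHom_conj j
  have e0 : freeGen ((rot ^ 0)⁻¹ * 1) = .inr (-1, 1) := rfl
  have e1 : freeGen ((rot ^ 1)⁻¹ * 1) = .inr (1, -1) * .inl (.of true) := rfl
  have e3 : freeGen ((rot ^ 3)⁻¹ * 1) = .inr (1, -1) := rfl
  have h1 : (freeWreathHom ((xConj 3 * xConj 1) ^ 2)).left 1 = .inl (.of true ^ 2) := by
    have : (freeWreathHom ((xConj 3 * xConj 1) ^ 2)).left 1 =
        freeGen ((rot ^ 3)⁻¹ * 1) * freeGen ((rot ^ 1)⁻¹ * 1) *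
          (freeGen ((rot ^ 3)⁻¹ * 1) * freeGen ((rot ^ 1)⁻¹ * 1)) := by
      rw [pow_two, map_mul, map_mul, hx, hx]
      simp
    rw [this, e1, e3, ← mul_assoc (SemidirectProduct.inr _), inr_mul_inr_self, one_mul, ← map_mul,
      pow_two]
  have h2 : (freeWreathHom (xConj 0 * (xConj 3 * xConj 1) ^ 2 * (xConj 0)⁻¹)).left 1 =
      .inl (.of false ^ 2) := by
    have : (freeWreathHom (xConj 0 * (xConj 3 * xConj 1) ^ 2 * (xConj 0)⁻¹)).left 1 =
        freeGen ((rot ^ 0)⁻¹ * 1) * (freeWreathHom ((xConj 3 * xConj 1) ^ 2)).left 1 *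
          (freeGen ((rot ^ 0)⁻¹ * 1))⁻¹ := by
      have hr : (freeWreathHom ((xConj 3 * xConj 1) ^ 2)).right = 1 := by
        rw [map_pow, map_mul, hx, hx, pow_two]
        simp
      rw [map_mul, map_mul, map_inv, hx]
      simp [hr, -map_pow, -map_mul]
    rw [this, h1, e0, ← map_inv, ← SemidirectProduct.inl_aut, fourAction_fst, map_pow, exchange_of]
    rfl
  refine ⟨⟨_, xConj_mul_xConj_sq_mem_E 3 1⟩,
    ⟨_, Subgroup.Normal.conj_mem inferInstance _ (xConj_mul_xConj_sq_mem_E 3 1) (xConj 0)⟩, ?_⟩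
  simp only [freeHom, MonoidHom.coe_mk, OneHom.coe_mk, h1, h2, SemidirectProduct.left_inl]
  decide

theorem exists_surjective_freeGroup :
    ∃ (α : Type) (_ : Nontrivial α) (φ : E →* FreeGroup α), Function.Surjective φ := by
  have e := IsFreeGroup.toFreeGroup freeHom.range
  refine ⟨IsFreeGroup.Generators freeHom.range, ?_, e.toMonoidHom.comp freeHom.rangeRestrict,
    e.surjective.comp freeHom.rangeRestrict_surjective⟩
  by_contra h
  rw [not_nontrivial_iff_subsingleton] at h
  obtain ⟨a, b, hab⟩ := freeHom_noncomm
  have hc : ∀ u v : FreeGroup (IsFreeGroup.Generators freeHom.range), u * v = v * u := by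
    rcases isEmpty_or_nonempty (IsFreeGroup.Generators freeHom.range) with h' | ⟨⟨x⟩⟩
    · exact fun u v => Subsingleton.elim _ _
    · have : Unique (IsFreeGroup.Generators freeHom.range) := ⟨⟨x⟩, fun y => Subsingleton.elim _ _⟩
      exact fun u v => (IsCyclic.isMulCommutative (α := _)).is_comm.comm u v
  refine hab ?_
  have := e.injective (((map_mul e _ _).trans (hc (e (freeHom.rangeRestrict a))
    (e (freeHom.rangeRestrict b)))).trans (map_mul e _ _).symm)
  exact congrArg Subtype.val this

/-! ### The family of quotients -/

/-- The elements of `E` that act trivially on the tree with parameter `s`. -/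
def treeKer (s : ℕ → Bool) : Subgroup G := (treeHom s).ker ⊓ E

instance (s : ℕ → Bool) : (treeKer s).Normal := Subgroup.normal_inf_normal _ _

instance : E.FiniteIndex := ⟨by rw [index_E]; norm_num⟩

theorem isPGroup_quotient_treeKer (s : ℕ → Bool) : IsPGroup 2 (G ⧸ treeKer s) := by
  intro z
  obtain ⟨g, rfl⟩ := QuotientGroup.mk_surjective z
  obtain ⟨k, hk⟩ := treeHom_isTwoElement s g
  -- The factor `2 ^ k` trivializes the tree action; `2 ^ 6` is the index of `E`.
  refine ⟨k + 6, ?_⟩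
  rw [← QuotientGroup.mk_pow, QuotientGroup.eq_one_iff]
  refine ⟨?_, ?_⟩
  · refine MonoidHom.mem_ker.mpr ?_
    rw [map_pow, pow_add, pow_mul, hk, one_pow]
  · rw [pow_add, mul_comm, pow_mul]
    refine pow_mem ?_ _
    rw [← index_E]
    exact Subgroup.pow_index_mem E g

theorem residuallyFinite_quotient {H : Type*} [Group H] (K : Subgroup H) [K.Normal]
    (h : ∀ g ∉ K, ∃ P : Subgroup H, P.FiniteIndex ∧ K ≤ P ∧ g ∉ P) :
    Group.ResiduallyFinite (H ⧸ K) := by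
  rw [Group.residuallyFinite_iff_exists_finiteIndex]
  intro z hz
  obtain ⟨g, rfl⟩ := QuotientGroup.mk_surjective z
  obtain ⟨P, hP, hKP, hg⟩ := h g fun hg => hz ((QuotientGroup.eq_one_iff g).mpr hg)
  refine ⟨P.map (QuotientGroup.mk' K), ⟨?_⟩, ?_⟩
  · exact ne_zero_of_dvd_ne_zero hP.index_ne_zero
      (Subgroup.index_map_dvd P (QuotientGroup.mk'_surjective K))
  · rintro ⟨p, hp, e⟩
    have := hKP (QuotientGroup.eq.mp e)
    exact hg (by simpa using mul_mem hp this)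

/-- Elements outside `E` are detected by `E` itself, the others by the stabilizer of a vertex they
move; orbits stay within a finite level. -/
theorem residuallyFinite_quotient_treeKer (s : ℕ → Bool) :
    Group.ResiduallyFinite (G ⧸ treeKer s) := by
  refine residuallyFinite_quotient _ fun g hg => ?_
  by_cases hE : g ∈ E
  · have hker : treeHom s g ≠ 1 := fun h => hg ⟨h, hE⟩
    obtain ⟨l, hl⟩ : ∃ l, treeHom s g l ≠ l := by
      by_contra h
      push Not at h
      exact hker (Equiv.ext h)
    let := MulAction.compHom (List Bool) (treeHom s)
    refine ⟨MulAction.stabilizer G l, ⟨?_⟩, fun k hk => ?_, hl⟩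
    · rw [MulAction.index_stabilizer]
      have hfin : (MulAction.orbit G l).Finite := by
        refine (List.finite_length_eq Bool l.length).subset ?_
        rintro _ ⟨g, rfl⟩
        exact length_treeHom s g l
      exact ((Set.ncard_pos hfin).mpr ⟨l, MulAction.mem_orbit_self l⟩).ne'
    · exact DFunLike.congr_fun (MonoidHom.mem_ker.mp hk.1) l
  · exact ⟨E, inferInstance, inf_le_right, hE⟩

/-! ### Counting isomorphism classes -/

theorem finite_image_of_forall_mem_inf {H M : Type*} [Group H] [Group M] (ψ : H →* M)
    (L F : Subgroup H) [F.Normal] [F.FiniteIndex] (h : ∀ g ∈ L, g ∈ F → ψ g = 1) :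
    (ψ '' L).Finite := by
  let q : L ⧸ F.subgroupOf L →* M := QuotientGroup.lift (F.subgroupOf L) (ψ.comp L.subtype)
    fun g hg => h g g.2 hg
  refine (Set.finite_range q).subset ?_
  rintro _ ⟨g, hg, rfl⟩
  exact ⟨QuotientGroup.mk ⟨g, hg⟩, rfl⟩

/-- An isomorphism yields an epimorphism from `G` onto a fixed countable group, determined by two
images. This recovers only `treeKer s'`; the image of `(treeHom s').ker`, finite because `E` has
finite index, recovers `s'` as well. Such data are countable. -/
theorem countable_setOf_mulEquiv (s : ℕ → Bool) :
    {s' | Nonempty ((G ⧸ treeKer s') ≃* (G ⧸ treeKer s))}.Countable := by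
  have : Countable (G ⧸ treeKer s) := by
    have : Countable G := (QuotientGroup.mk'_surjective _).countable
    exact (QuotientGroup.mk'_surjective (treeKer s)).countable
  let e (s' : {s' | Nonempty ((G ⧸ treeKer s') ≃* (G ⧸ treeKer s))}) : G →* G ⧸ treeKer s :=
    s'.2.some.toMonoidHom.comp (QuotientGroup.mk' (treeKer s'))
  have hker : ∀ s', (e s').ker = treeKer s' := fun s' => by
    ext g
    simp [e]
  have hfin : ∀ s', (e s' '' (treeHom s').ker).Finite := fun s' =>
    finite_image_of_forall_mem_inf _ _ E fun g hg hE => by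
      rw [← MonoidHom.mem_ker, hker]
      exact ⟨hg, hE⟩
  refine Set.countable_coe_iff.mp (Function.Injective.countable
    (f := fun s' => ((e s' (.of 0), e s' (.of 1)), (hfin s').toFinset)) ?_)
  intro s₁ s₂ h
  simp only [Prod.mk.injEq, Set.Finite.toFinset_inj] at h
  obtain ⟨⟨hx, hy⟩, hL⟩ := h
  have he : e s₁ = e s₂ := PresentedGroup.ext fun i => by
    fin_cases i
    · exact hx
    · exact hy
  refine Subtype.ext (ker_treeHom_injective ?_)
  have key : ∀ s' : {s' | Nonempty ((G ⧸ treeKer s') ≃* (G ⧸ treeKer s))},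
      (treeHom s').ker = (((treeHom s').ker).map (e s')).comap (e s') := fun s' => by
    rw [Subgroup.comap_map_eq, hker, eq_comm, sup_eq_left]
    exact inf_le_left
  change (treeHom s₁).ker = (treeHom s₂).ker
  rw [key s₁, key s₂]
  have hmap : (treeHom s₁).ker.map (e s₁) = (treeHom s₂).ker.map (e s₂) := SetLike.coe_injective hL
  rw [hmap, he]

open Cardinal in
/-- An equivalence relation with countable classes on a set with the cardinality of the continuum
has a continuum of classes. -/
theorem exists_pairwise_not_rel {r : (ℕ → Bool) → (ℕ → Bool) → Prop} (hr : Equivalence r)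
    (hc : ∀ s, {s' | r s' s}.Countable) :
    ∃ f : (ℕ → Bool) → ℕ → Bool, ∀ s s', s ≠ s' → ¬ r (f s) (f s') := by
  let S : Setoid (ℕ → Bool) := ⟨r, hr⟩
  have hι : #(ℕ → Bool) = 𝔠 := by simp
  have hQ : #(ℕ → Bool) ≤ #(Quotient S) := by
    by_contra hlt
    rw [not_le, hι] at hlt
    have hcl : ∀ q : Quotient S, ∃ φ : (ℕ → Bool) → ℕ, Set.InjOn φ {s | Quotient.mk S s = q} := by
      intro q
      induction q using Quotient.inductionOn with
      | _ s =>
        have : {s' | Quotient.mk S s' = Quotient.mk S s} = {s' | r s' s} := by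
          ext s'
          exact Quotient.eq (r := S)
        rw [this]
        exact Set.countable_iff_exists_injOn.mp (hc s)
    choose φ hφ using hcl
    have hinj : Function.Injective fun s => (Quotient.mk S s, φ (Quotient.mk S s) s) := by
      intro s s' h
      obtain ⟨h1, h2⟩ := Prod.mk.inj h
      rw [h1] at h2
      exact hφ _ h1 rfl h2
    have hle := mk_le_of_injective hinj
    rw [hι, mk_prod, lift_id, lift_id, mk_nat] at hle
    -- With fewer than a continuum of classes, each countable, the total would stay below the
    -- continuum.
    exact absurd (hle.trans_lt (mul_lt_of_lt aleph0_le_continuum hlt aleph0_lt_continuum))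
      (lt_irrefl _)
  obtain ⟨j⟩ := hQ
  refine ⟨fun s => (j s).out, fun s s' hne h => hne (j.injective ?_)⟩
  exact Quotient.out_equiv_out.mp h

theorem exists_pairwise_not_mulEquiv : ∃ f : (ℕ → Bool) → ℕ → Bool,
    ∀ s s', s ≠ s' → IsEmpty ((G ⧸ treeKer (f s)) ≃* (G ⧸ treeKer (f s'))) := by
  obtain ⟨f, hf⟩ := exists_pairwise_not_rel
    (r := fun s s' => Nonempty ((G ⧸ treeKer s) ≃* (G ⧸ treeKer s')))
    ⟨fun _ => ⟨.refl _⟩, fun ⟨e⟩ => ⟨e.symm⟩, fun ⟨e⟩ ⟨e'⟩ => ⟨e.trans e'⟩⟩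
    countable_setOf_mulEquiv
  exact ⟨f, fun s s' hne => not_nonempty_iff.mp (hf s s' hne)⟩

theorem not_countable_setOf_isPGroup :
    ¬ {K : Subgroup G | ∃ _ : K.Normal, IsPGroup 2 (G ⧸ K)}.Countable := by
  intro h
  obtain ⟨f, hf⟩ := exists_pairwise_not_mulEquiv
  have := h.to_subtype
  let F (s : ℕ → Bool) : {K : Subgroup G | ∃ _ : K.Normal, IsPGroup 2 (G ⧸ K)} :=
    ⟨treeKer (f s), inferInstance, isPGroup_quotient_treeKer _⟩
  have hF : Function.Injective F := by
    intro s s' e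
    by_contra hne
    exact (hf s s' hne).false (QuotientGroup.quotientMulEquivOfEq (congrArg Subtype.val e))
  have hι : Cardinal.aleph0 < Cardinal.mk (ℕ → Bool) := by
    simpa using Cardinal.aleph0_lt_continuum
  exact (Cardinal.mk_le_aleph0_iff.mpr hF.countable).not_gt hι

end Wiegold

theorem mainTheorem8 :
    -- uncountably many quotients that are 2-groups
    ¬ {K : Subgroup Wiegold.G |
        ∃ _ : K.Normal, IsPGroup 2 (Wiegold.G ⧸ K)}.Countable ∧
    -- the explicit subgroup of index `2 ^ 6`
    Wiegold.E.index = 2 ^ 6 ∧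
    ∃ N : Subgroup Wiegold.G, N.Normal ∧ N ≤ Wiegold.E ∧
      (∃ l : ℕ, N.index = 2 ^ l) ∧
      -- `N` maps onto a non-abelian free group
      (∃ (α : Type) (_ : Nontrivial α) (φ : N →* FreeGroup α), Function.Surjective φ) ∧
      -- a continuum of pairwise non-isomorphic residually finite quotients that are 2-groups
      ∃ (K : (ℕ → Bool) → Subgroup Wiegold.G) (_ : ∀ ω, (K ω).Normal),
        (∀ ω, K ω ≤ N) ∧
        (∀ ω, IsPGroup 2 (Wiegold.G ⧸ K ω)) ∧
        (∀ ω, Group.ResiduallyFinite (Wiegold.G ⧸ K ω)) ∧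
        (∀ ω ω', ω ≠ ω' → IsEmpty ((Wiegold.G ⧸ K ω) ≃* (Wiegold.G ⧸ K ω'))) := by
  obtain ⟨f, hf⟩ := Wiegold.exists_pairwise_not_mulEquiv
  exact ⟨Wiegold.not_countable_setOf_isPGroup, Wiegold.index_E, Wiegold.E, inferInstance, le_rfl,
    ⟨6, Wiegold.index_E⟩, Wiegold.exists_surjective_freeGroup, fun ω => Wiegold.treeKer (f ω),
    fun _ => inferInstance, fun _ => inf_le_right, fun _ => Wiegold.isPGroup_quotient_treeKer _,
    fun _ => Wiegold.residuallyFinite_quotient_treeKer _, hf⟩
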